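/- Fix $m\ge 0$. For each integer $N\ge 1$ let $(A_N,\psi^{(N)})$ be a noncommutative probability space (a unital complex algebra with a linear functional satisfying $\psi^{(N)}(1)=1$) containing a free semicircular family $\{s(i,j,k): 1\le i\le j\le N,\ 1\le k\le m\}$, i.e. freely independent elements, each distributed according to the semicircle law $\gamma$ of density $\frac1{2\pi}\sqrt{4-x^2}$ on $[-2,2]$. Let $X_N(k)$ be the symmetric $N\times N$ matrix over $A_N$ whose $(i,j)$ and $(j,i)$ entries, for $i\le j$, are both equal to $\sqrt{(1+\delta_{ij})/N}\; s(i,j,k)$, so that these entries have variance $(1+\delta_{ij})/N$. Put $\psi_N=\frac1N\mathrm{Tr}\otimes\psi^{(N)}$ on $M_N(A_N)$. Then for every noncommutative polynomial $p\in\mathbb C\langle t_1,\dots,t_m\rangle$ the limits $$\mu(p)=\lim_{N\to\infty}\psi_N\big(p(X_N(1),\dots,X_N(m))\big),\qquad \mu'(p)=\lim_{N\to\infty}\frac{\psi_N\big(p(X_N(1),\dots,X_N(m))\big)-\mu(p)}{1/N}$$ exist, and $(\mu,\mu')$ is an infinitesimal law: $\mu,\mu'$ are linear, $\mu(1)=1$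 and $\mu'(1)=0$. Moreover: (a) the variables $t_1,\dots,t_m$ are infinitesimally free with respect to $(\mu,\mu')$: with $\mu_t=\mu+t\mu'$ for $t\in\mathbb R$, for all $n\ge1$, all indices $k_1,\dots,k_n\in\{1,\dots,m\}$ with $k_1\ne k_2\ne\cdots\ne k_n$ (consecutive indices distinct) and all polynomials $p_j\in\mathbb C[t_{k_j}]$, $$\mu_t\big((p_1-\mu_t(p_1))\cdots(p_n-\mu_t(p_n))\big)=o(t)\quad\text{as } t\to0;$$ (b) for each $k$, the restriction of $(\mu,\mu')$ to the variable $t_k$ is the infinitesimal (type B) semicircular law: for all $n\ge0$, $\mu(t_k^n)=\int x^n\,d\gamma(x)$ and $\mu'(t_k^n)=\int x^n\,d\alpha(x)-\int x^n\,d\gamma(x)$, where $\alpha$ is the arcsine law of density $\frac1{\pi\sqrt{4-x^2}}$ on $(-2,2)$. -/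

import Mathlib

open Filter Topology MeasureTheory Asymptotics

noncomputable section

namespace InfFree

/-! ### Freeness in a noncommutative probability space

A noncommutative probability space is a unital complex algebra `A` with a linear functional
`φ : A →ₗ[ℂ] ℂ` such that `φ 1 = 1`. -/

/-- Unital subalgebras `S i` are freely independent with respect to `φ`: `φ (a₁ ⋯ aₙ) = 0`
whenever `n ≥ 1`, `aⱼ ∈ S (iⱼ)`, `φ aⱼ = 0` and consecutive indices `iⱼ` are distinct. The word
`a₁ ⋯ aₙ` together with its indices is given as a list of pairs `(iⱼ, aⱼ)`. -/
def FreelyIndependent {A : Type*} [Ring A] [Algebra ℂ A] (φ : A →ₗ[ℂ] ℂ) {ι : Type*}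
    (S : ι → Subalgebra ℂ A) : Prop :=
  ∀ w : List (ι × A), w ≠ [] →
    (∀ x ∈ w, x.2 ∈ S x.1) →
    (∀ x ∈ w, φ x.2 = 0) →
    w.IsChain (fun x y => x.1 ≠ y.1) →
    φ (w.map Prod.snd).prod = 0

/-- The (standard) semicircle law on `ℝ`, with density `√(4 - x²) / (2π)` on `[-2, 2]`.
(Outside this interval the real square root vanishes.) -/
def semicircleLaw : Measure ℝ :=
  volume.withDensity (fun x => ENNReal.ofReal (√(4 - x ^ 2) / (2 * Real.pi)))

/-- The arcsine law on `(-2, 2)`, with density `1 / (π √(4 - x²))`. (Outside this interval the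
real square root vanishes, and so does the quotient.) -/
def arcsineLaw : Measure ℝ :=
  volume.withDensity (fun x => ENNReal.ofReal (1 / (Real.pi * √(4 - x ^ 2))))

/-- The `n`-th moment of a measure on the line, as a complex number. -/
def moment (ν : Measure ℝ) (n : ℕ) : ℂ := ((∫ x, x ^ n ∂ν : ℝ) : ℂ)

/-- `a` is a (standard) semicircular variable: its law is the semicircle law of variance `1`. -/
def IsSemicircularVar {A : Type*} [Ring A] [Algebra ℂ A] (φ : A →ₗ[ℂ] ℂ) (a : A) : Prop :=
  ∀ n : ℕ, φ (a ^ n) = moment semicircleLaw n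

/-- A free semicircular family: freely independent standard semicircular variables. -/
structure IsFreeSemicircularFamily {A : Type*} [Ring A] [Algebra ℂ A] (φ : A →ₗ[ℂ] ℂ)
    {ι : Type*} (s : ι → A) : Prop where
  semicircular : ∀ i, IsSemicircularVar φ (s i)
  free : FreelyIndependent φ (fun i => Algebra.adjoin ℂ {s i})

/-! ### Infinitesimal laws -/

/-- An infinitesimal law of the variables `t i`, `i : ι`: a pair of linear functionals on the
algebra of noncommutative polynomials, the first with value `1` and the second with value `0`
at the constant polynomial `1`. -/
structure InfinitesimalLaw (ι : Type*) where
  zeroth : FreeAlgebra ℂ ι →ₗ[ℂ] ℂ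
  first : FreeAlgebra ℂ ι →ₗ[ℂ] ℂ
  zeroth_one : zeroth 1 = 1
  first_one : first 1 = 0

namespace InfinitesimalLaw

variable {ι : Type*}

/-- The family of laws `μ + t μ'`. -/
def lawAt (L : InfinitesimalLaw ι) (t : ℝ) : FreeAlgebra ℂ ι →ₗ[ℂ] ℂ :=
  L.zeroth + (t : ℂ) • L.first

/-- The restriction of an infinitesimal law to the single variable `t k`. -/
def restrict (L : InfinitesimalLaw ι) (k : ι) : InfinitesimalLaw Unit where
  zeroth := L.zeroth ∘ₗ
    (FreeAlgebra.lift ℂ (fun _ : Unit => FreeAlgebra.ι ℂ k)).toLinearMap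
  first := L.first ∘ₗ
    (FreeAlgebra.lift ℂ (fun _ : Unit => FreeAlgebra.ι ℂ k)).toLinearMap
  zeroth_one := by simp [L.zeroth_one]
  first_one := by simp [L.first_one]

/-- Subalgebras `S k` of the noncommutative polynomials are infinitesimally free: they are free
to order `t` with respect to the laws `μ + t μ'`, that is, if `p₁, …, pₙ` (with `n ≥ 1`) lie
in `S (k₁), …, S (kₙ)`, consecutive indices being distinct, then
`(μ + t μ') ((p₁ - (μ + t μ') p₁) ⋯ (pₙ - (μ + t μ') pₙ)) = o(t)` as `t → 0`. -/
def InfinitesimallyFree (L : InfinitesimalLaw ι) {κ : Type*}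
    (S : κ → Subalgebra ℂ (FreeAlgebra ℂ ι)) : Prop :=
  ∀ w : List (κ × FreeAlgebra ℂ ι), w ≠ [] →
    (∀ x ∈ w, x.2 ∈ S x.1) →
    w.IsChain (fun x y => x.1 ≠ y.1) →
    (fun t : ℝ =>
      L.lawAt t (w.map fun x =>
        x.2 - algebraMap ℂ (FreeAlgebra ℂ ι) (L.lawAt t x.2)).prod)
      =o[𝓝[≠] 0] (fun t : ℝ => t)

/-- The variables `t k` themselves are infinitesimally free. -/
def VariablesInfinitesimallyFree (L : InfinitesimalLaw ι) : Prop :=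
  L.InfinitesimallyFree (fun k : ι => Algebra.adjoin ℂ {FreeAlgebra.ι ℂ k})

/-- The infinitesimal (type B) semicircular law of one variable: `μ` is given by the semicircle
law, and `μ'` by the difference of the arcsine law and the semicircle law. -/
def IsSemicircular (L : InfinitesimalLaw Unit) : Prop :=
  ∀ n : ℕ,
    L.zeroth (FreeAlgebra.ι ℂ () ^ n) = moment semicircleLaw n ∧
    L.first (FreeAlgebra.ι ℂ () ^ n) = moment arcsineLaw n - moment semicircleLaw n

/-- `L = (μ, μ')` is the infinitesimal law, as `1/N → 0`, of a sequence of laws `φ N`: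
`μ p = lim φ N p` and `μ' p = lim (φ N p - μ p) / (1/N)`, both limits existing for all `p`. -/
def IsInfinitesimalLimit (L : InfinitesimalLaw ι) (φ : ℕ → FreeAlgebra ℂ ι →ₗ[ℂ] ℂ) : Prop :=
  ∀ p : FreeAlgebra ℂ ι,
    Tendsto (fun N => φ N p) atTop (𝓝 (L.zeroth p)) ∧
    Tendsto (fun N : ℕ => (φ N p - L.zeroth p) / (1 / (N : ℂ))) atTop (𝓝 (L.first p))

end InfinitesimalLaw

/-! ### The matrix model -/

/-- The functional `(1/N) Tr ⊗ φ` on `N × N` matrices over `A`. -/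
def matrixFunctional {A : Type*} [Ring A] [Algebra ℂ A] (φ : A →ₗ[ℂ] ℂ) (N : ℕ) :
    Matrix (Fin N) (Fin N) A →ₗ[ℂ] ℂ :=
  (1 / (N : ℂ)) • (φ ∘ₗ Matrix.traceLinearMap (Fin N) ℂ A)

/-- The joint law, with respect to `φ`, of variables `x k`, `k : ι`. -/
def jointLaw {A : Type*} [Ring A] [Algebra ℂ A] (φ : A →ₗ[ℂ] ℂ) {ι : Type*} (x : ι → A) :
    FreeAlgebra ℂ ι →ₗ[ℂ] ℂ :=
  φ ∘ₗ (FreeAlgebra.lift ℂ x).toLinearMap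

/-- The index set `{(i, j, k) : i ≤ j}` of the semicircular variables in `m` matrices of
size `N`. -/
abbrev EntryIndex (N m : ℕ) : Type :=
  {e : Fin N × Fin N × Fin m // e.1 ≤ e.2.1}

/-- The symmetric matrix `X_N(k)`: for `i ≤ j` its entries at `(i, j)` and `(j, i)` are both
`√((1 + δ_{ij}) / N) • s(i, j, k)`, a variable of variance `(1 + δ_{ij}) / N`. -/
def semicircularMatrix {A : Type*} [Ring A] [Algebra ℂ A] {N m : ℕ} (s : EntryIndex N m → A)
    (k : Fin m) : Matrix (Fin N) (Fin N) A :=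
  Matrix.of fun i j =>
    ((√((1 + if i = j then 1 else 0) / (N : ℝ)) : ℝ) : ℂ) •
      s ⟨(min i j, max i j, k), min_le_max⟩

end InfFree

end

/-!
A free family of standard semicircular variables is characterized by the vanishing of its state at
all nontrivial Wick polynomials, which are the noncommutative Chebyshev polynomials of the second
kind. On the one hand, a product of centered polynomials in alternating variables is a combination
of such Wick polynomials. On the other hand, for variables of the form `a i + b i` with
`b i * a j = δ i j`, the normal ordering of a Wick polynomial contains a single term not ending in
some `b j`, namely a product of the `a i`; a state that kills everything beginning with some `a i`
or ending with some `b i` therefore satisfies the characterization.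

Realize the entries `s (i, j, k)` as creation plus annihilation operators on a full Fock space.
Then `X_N(k) = a k + b k`, where the matrices `a k` of creation operators and `b k` of annihilation
operators satisfy `b k * a l = δ k l * (1 + 1/N)`, the constant being the sum of the variances
along a row. Hence the `X_N(k)` are, for every `N`, *exactly* free and semicircular, of variance
`1 + 1/N`, and the infinitesimal law is the derivative at `t = 0` of the law of a free semicircular
family of variance `1 + t`. It is infinitesimally free because it agrees with exactly free laws up
to `o(t)`, and `μ' (t_k ^ n) = (n / 2) * μ (t_k ^ n)` is the difference of the arcsine and
semicircle moments by the Wallis recursion.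
-/

noncomputable section

namespace InfFree

open Polynomial (aeval)
open Polynomial.Chebyshev (S T S_add_two measureT)

/-! ### Wick polynomials -/

theorem span_range_eq_top_of_mul_mem {R A α : Type*} [CommSemiring R] [Semiring A] [Algebra R A]
    {s : Set A} (hs : Algebra.adjoin R s = ⊤) {f : α → A}
    (hone : 1 ∈ Submodule.span R (Set.range f))
    (hmul : ∀ a ∈ s, ∀ i, a * f i ∈ Submodule.span R (Set.range f)) :
    Submodule.span R (Set.range f) = ⊤ := by
  set K := Submodule.span R (Set.range f)
  have hK : ∀ a ∈ Algebra.adjoin R s, ∀ q ∈ K, a * q ∈ K := by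
    intro a ha
    induction ha using Algebra.adjoin_induction with
    | mem a ha =>
      exact fun q hq => Submodule.span_le (p := K.comap (LinearMap.mulLeft R a)) |>.2
        (Set.range_subset_iff.2 (hmul a ha)) hq
    | algebraMap r => exact fun q hq => by simpa [← Algebra.smul_def] using K.smul_mem r hq
    | add a b _ _ ha hb => exact fun q hq => by simpa [add_mul] using add_mem (ha q hq) (hb q hq)
    | mul a b _ _ ha hb => exact fun q hq => by simpa [mul_assoc] using ha _ (hb q hq)
  exact eq_top_iff.2 fun p _ => by simpa using hK p (hs ▸ trivial) 1 hone

theorem span_chebyshev_S (R : Type*) [CommRing R] :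
    Submodule.span R (Set.range fun k : ℕ => S R k) = ⊤ := by
  have hS (k : ℕ) : S R k ∈ Submodule.span R (Set.range fun k : ℕ => S R k) :=
    Submodule.subset_span ⟨k, rfl⟩
  refine span_range_eq_top_of_mul_mem Polynomial.adjoin_X (by simpa using hS 0) ?_
  rintro _ rfl (_ | k)
  · simpa using hS 1
  · have hX : Polynomial.X * S R (k + 1 : ℕ) = S R (k + 2 : ℕ) + S R k := by
      push_cast
      rw [S_add_two, sub_add_cancel]
    exact hX ▸ add_mem (hS _) (hS k)

section Wick

variable (R : Type*) [CommRing R] {ι : Type*}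

theorem span_prod_map_ι :
    Submodule.span R (Set.range fun v : List ι => (v.map (FreeAlgebra.ι R)).prod) = ⊤ := by
  refine span_range_eq_top_of_mul_mem (FreeAlgebra.adjoin_range_ι R ι)
    (Submodule.subset_span ⟨[], rfl⟩) ?_
  rintro _ ⟨i, rfl⟩ v
  exact Submodule.subset_span ⟨i :: v, by simp⟩

variable [DecidableEq ι]

/-- The noncommutative Wick polynomial of a word, defined by the recursion
`W (i j v) = t i * W (j v) - δ i j * W v` of the Chebyshev polynomials of the second kind. -/
def wick : List ι → FreeAlgebra R ι
  | [] => 1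
  | [i] => FreeAlgebra.ι R i
  | i :: j :: v => FreeAlgebra.ι R i * wick (j :: v) - if i = j then wick v else 0

theorem span_wick : Submodule.span R (Set.range (wick R (ι := ι))) = ⊤ := by
  have hW (v : List ι) : wick R v ∈ Submodule.span R (Set.range (wick R)) :=
    Submodule.subset_span ⟨v, rfl⟩
  refine span_range_eq_top_of_mul_mem (FreeAlgebra.adjoin_range_ι R ι) (hW []) ?_
  rintro _ ⟨i, rfl⟩ (_ | ⟨j, v⟩)
  · simpa [wick] using hW [i]
  · rw [← sub_add_cancel (FreeAlgebra.ι R i * wick R (j :: v)) (if i = j then wick R v else 0)]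
    refine add_mem (hW (i :: j :: v)) ?_
    split_ifs
    exacts [hW v, zero_mem _]

variable {R}

/-- `J` vanishes at all nontrivial Wick polynomials, which characterizes the joint law of a free
family of standard semicircular variables. -/
def IsWickLaw (J : FreeAlgebra R ι →ₗ[R] R) : Prop :=
  ∀ v, J (wick R v) = if v = [] then 1 else 0

theorem IsWickLaw.eq {J J' : FreeAlgebra R ι →ₗ[R] R} (h : IsWickLaw J) (h' : IsWickLaw J') :
    J = J' := by
  refine LinearMap.ext_on (span_wick R) ?_
  rintro _ ⟨v, rfl⟩
  rw [h, h']

theorem IsWickLaw.map_one {J : FreeAlgebra R ι →ₗ[R] R} (h : IsWickLaw J) : J 1 = 1 := by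
  simpa [wick] using h []

end Wick

/-! ### Creation and annihilation -/

section Ladder

variable {R B ι : Type*} [CommRing R] [Ring B] [Algebra R B] [DecidableEq ι]

/-- `a i` and `b i` behave under `φ` like creation and annihilation operators, the sums
`a i + b i` having variance `v`. -/
structure IsLadderSystem (φ : B →ₗ[R] R) (v : R) (a b : ι → B) : Prop where
  annihilation_mul_creation : ∀ i j, b i * a j = if i = j then v • 1 else 0
  map_creation_mul : ∀ i y, φ (a i * y) = 0
  map_mul_annihilation : ∀ i y, φ (y * b i) = 0

theorem IsLadderSystem.smul {φ : B →ₗ[R] R} {v : R} {a b : ι → B} (h : IsLadderSystem φ v a b)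
    (c : R) : IsLadderSystem φ (c ^ 2 * v) (c • a) (c • b) where
  annihilation_mul_creation i j := by
    simp only [Pi.smul_apply, smul_mul_smul_comm, h.annihilation_mul_creation, smul_ite,
      smul_smul, smul_zero, sq]
  map_creation_mul i y := by simp [h.map_creation_mul]
  map_mul_annihilation i y := by simp [h.map_mul_annihilation]

/-- In normal order, only the pure creation term of a Wick polynomial of the variables
`a i + b i` does not end in an annihilator. -/
theorem lift_wick_sub_prod_mem {a b : ι → B} (h : ∀ i j, b i * a j = if i = j then 1 else 0) :
    ∀ v : List ι,
      FreeAlgebra.lift R (a + b) (wick R v) - (v.map a).prod ∈ Ideal.span (Set.range b)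
  | [] => by simp [wick]
  | [i] => by simpa [wick] using Ideal.subset_span (Set.mem_range_self i)
  | i :: j :: v => by
    have hjv := Ideal.mul_mem_left _ (a i + b i) (lift_wick_sub_prod_mem h (j :: v))
    have hv := lift_wick_sub_prod_mem h v
    have hba : b i * (a j * (v.map a).prod) = if i = j then (v.map a).prod else 0 := by
      rw [← mul_assoc, h, ite_mul, one_mul, zero_mul]
    simp only [List.map_cons, List.prod_cons, mul_sub, add_mul, hba] at hjv
    simp only [wick, map_sub, map_mul, FreeAlgebra.lift_ι_apply, Pi.add_apply, List.map_cons,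
      List.prod_cons, add_mul]
    split_ifs at hjv ⊢
    · convert sub_mem hjv hv using 1
      abel
    · convert hjv using 1
      simp

theorem IsLadderSystem.isWickLaw {φ : B →ₗ[R] R} {a b : ι → B} (h : IsLadderSystem φ 1 a b)
    (hφ : φ 1 = 1) : IsWickLaw (φ ∘ₗ (FreeAlgebra.lift R (a + b)).toLinearMap) := by
  have hspan : ∀ x ∈ Ideal.span (Set.range b), ∀ y, φ (y * x) = 0 := by
    intro x hx
    induction hx using Submodule.span_induction with
    | mem x hx =>
      obtain ⟨i, rfl⟩ := hx
      exact h.map_mul_annihilation i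
    | zero => simp
    | add x z _ _ hx hz => simp [mul_add, hx, hz]
    | smul c x _ hx => simp [← mul_assoc, hx]
  intro v
  have hba : ∀ i j, b i * a j = if i = j then 1 else 0 := by
    simpa using h.annihilation_mul_creation
  have hv := hspan _ (lift_wick_sub_prod_mem (R := R) hba v) 1
  rw [one_mul, map_sub, sub_eq_zero] at hv
  rw [LinearMap.comp_apply, AlgHom.toLinearMap_apply, hv]
  cases v with
  | nil => simpa using hφ
  | cons i v => simpa using h.map_creation_mul i _

end Ladder

section Fock

variable {R ι : Type*} [CommRing R]

variable (R ι) in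
/-- The algebraic full Fock space of the free module with basis `ι`: words in `ι` index the
elementary tensors. -/
abbrev Fock : Type _ := List ι →₀ R

/-- The left creation operator of a basis vector on the full Fock space. -/
def creation (i : ι) : Module.End R (Fock R ι) := Finsupp.lmapDomain R R (List.cons i)

/-- The left annihilation operator of a basis vector on the full Fock space. -/
def annihilation (i : ι) : Module.End R (Fock R ι) :=
  Finsupp.lcomapDomain (List.cons i) List.cons_injective

variable (R ι) in
/-- The vacuum expectation `T ↦ ⟨T Ω, Ω⟩`, where the vacuum `Ω` is the empty word. -/
def vacuumState : Module.End R (Fock R ι) →ₗ[R] R :=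
  Finsupp.lapply [] ∘ₗ LinearMap.applyₗ (Finsupp.single [] 1)

theorem vacuumState_one : vacuumState R ι 1 = 1 := by simp [vacuumState]

theorem annihilation_vacuum (i : ι) :
    annihilation i (Finsupp.single [] 1 : Fock R ι) = 0 := by
  ext v
  simp [annihilation, Finsupp.lcomapDomain]

theorem annihilation_mul_creation [DecidableEq ι] (i j : ι) :
    annihilation i * creation j = (if i = j then 1 else 0 : Module.End R (Fock R ι)) := by
  ext v : 1
  refine LinearMap.ext fun c => Finsupp.ext fun w => ?_
  change Finsupp.mapDomain (List.cons j) (Finsupp.single v c) (i :: w) = _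
  rw [Finsupp.mapDomain_single]
  split_ifs with hij <;> simp [Finsupp.single_apply, hij]

theorem isLadderSystem_fock [DecidableEq ι] :
    IsLadderSystem (B := Module.End R (Fock R ι)) (vacuumState R ι) 1 creation annihilation where
  annihilation_mul_creation i j := by rw [annihilation_mul_creation, one_smul]
  map_creation_mul i T := Finsupp.mapDomain_of_notMem_range _ _ (by simp)
  map_mul_annihilation i T := by simp [vacuumState, annihilation_vacuum]

end Fock

/-- The joint law of a free family of semicircular variables of variance `1`. -/
def standardSemicircularLaw (ι : Type*) : FreeAlgebra ℂ ι →ₗ[ℂ] ℂ :=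
  jointLaw (vacuumState ℂ ι) (creation + annihilation)

theorem isWickLaw_standardSemicircularLaw (ι : Type*) [DecidableEq ι] :
    IsWickLaw (standardSemicircularLaw ι) :=
  isLadderSystem_fock.isWickLaw vacuumState_one

/-! ### Freeness -/

section Freeness

variable {A κ : Type*} [Ring A] [Algebra ℂ A] {φ : A →ₗ[ℂ] ℂ} {S : κ → Subalgebra ℂ A}

theorem FreelyIndependent.comap {B : Type*} [Ring B] [Algebra ℂ B] (hS : FreelyIndependent φ S)
    (f : B →ₐ[ℂ] A) {T : κ → Subalgebra ℂ B} (hT : ∀ i, T i ≤ (S i).comap f) :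
    FreelyIndependent (φ ∘ₗ f.toLinearMap) T := by
  intro w hw hmem hzero hchain
  have h := hS (w.map fun x => (x.1, f x.2)) (by simpa using hw)
    (List.forall_mem_map.2 fun x hx => hT _ (hmem x hx)) (List.forall_mem_map.2 hzero)
    (by rwa [List.isChain_map])
  simpa [map_list_prod, Function.comp_def] using h

theorem FreelyIndependent.map_prod_sub (hS : FreelyIndependent φ S) (hφ : φ 1 = 1)
    {w : List (κ × A)} (hw : w ≠ []) (hmem : ∀ x ∈ w, x.2 ∈ S x.1)
    (hchain : w.IsChain fun x y => x.1 ≠ y.1) :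
    φ (w.map fun x => x.2 - algebraMap ℂ A (φ x.2)).prod = 0 := by
  have h := hS (w.map fun x => (x.1, x.2 - algebraMap ℂ A (φ x.2))) (by simpa using hw)
    (List.forall_mem_map.2 fun x hx => sub_mem (hmem x hx) (algebraMap_mem _ _))
    (List.forall_mem_map.2 fun x _ => by simp [Algebra.algebraMap_eq_smul_one, hφ])
    (by rwa [List.isChain_map])
  simpa [Function.comp_def] using h

variable (φ S) in
/-- The products `a₁ ⋯ aₙ`, `n ≥ 0`, of centered elements `aⱼ ∈ S (iⱼ)` with `iⱼ ≠ iⱼ₊₁`. The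
first argument records the index `i₁` of the first factor, if there is one. -/
inductive IsAlternatingProduct : Option κ → A → Prop
  | one : IsAlternatingProduct none 1
  | mul {o : Option κ} {i : κ} {a b : A} : a ∈ S i → φ a = 0 → o ≠ some i →
      IsAlternatingProduct o b → IsAlternatingProduct (some i) (a * b)

theorem isAlternatingProduct_prod : ∀ w : List (κ × A), (∀ x ∈ w, x.2 ∈ S x.1) →
    (∀ x ∈ w, φ x.2 = 0) → (w.IsChain fun x y => x.1 ≠ y.1) →
    IsAlternatingProduct φ S (w.head?.map Prod.fst) (w.map Prod.snd).prod
  | [], _, _, _ => .one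
  | x :: w, hmem, hzero, hchain => by
    rw [List.forall_mem_cons] at hmem hzero
    rw [List.isChain_cons] at hchain
    refine .mul hmem.1 hzero.1 ?_ (isAlternatingProduct_prod w hmem.2 hzero.2 hchain.2)
    intro h
    obtain ⟨y, hy, hyx⟩ := Option.map_eq_some_iff.1 h
    exact hchain.1 y hy hyx.symm

theorem IsAlternatingProduct.exists_list {o : Option κ} {a : A}
    (h : IsAlternatingProduct φ S o a) :
    ∃ w : List (κ × A), (∀ x ∈ w, x.2 ∈ S x.1) ∧ (∀ x ∈ w, φ x.2 = 0) ∧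
      (w.IsChain fun x y => x.1 ≠ y.1) ∧ w.head?.map Prod.fst = o ∧
      (w.map Prod.snd).prod = a := by
  induction h with
  | one => exact ⟨[], by simp⟩
  | @mul o i a b ha hφa ho _ ih =>
    obtain ⟨w, hmem, hzero, hchain, rfl, rfl⟩ := ih
    refine ⟨(i, a) :: w, List.forall_mem_cons.2 ⟨ha, hmem⟩, List.forall_mem_cons.2 ⟨hφa, hzero⟩,
      List.isChain_cons.2 ⟨fun y hy hyi => ho ?_, hchain⟩, rfl, List.prod_cons⟩
    rw [Option.mem_def.1 hy, Option.map_some, ← hyi]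

theorem freelyIndependent_iff :
    FreelyIndependent φ S ↔ ∀ i a, IsAlternatingProduct φ S (some i) a → φ a = 0 := by
  refine ⟨fun h i a ha => ?_, fun h w hw hmem hzero hchain => ?_⟩
  · obtain ⟨w, hmem, hzero, hchain, hhead, rfl⟩ := ha.exists_list
    exact h w (by rintro rfl; simp at hhead) hmem hzero hchain
  · obtain ⟨x, w, rfl⟩ := List.exists_cons_of_ne_nil hw
    exact h x.1 _ (isAlternatingProduct_prod _ hmem hzero hchain)

end Freeness

/-! ### Freeness and Wick polynomials -/

section FreenessWick

theorem mem_span_aeval_chebyshev_S_succ {R A : Type*} [CommRing R] [Ring A] [Algebra R A]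
    {φ : A →ₗ[R] R} (hφ : φ 1 = 1) {a : A} (ha : ∀ k : ℕ, φ (aeval a (S R (k + 1 : ℕ))) = 0)
    {x : A} (hx : x ∈ Algebra.adjoin R {a}) (hx0 : φ x = 0) :
    x ∈ Submodule.span R (Set.range fun k : ℕ => aeval a (S R (k + 1 : ℕ))) := by
  set K := Submodule.span R (Set.range fun k : ℕ => aeval a (S R (k + 1 : ℕ)))
  have hK : K ≤ LinearMap.ker φ := Submodule.span_le.2 (Set.range_subset_iff.2 ha)
  have hx' : x ∈ Submodule.span R
      (insert 1 (Set.range fun k : ℕ => aeval a (S R (k + 1 : ℕ)))) := by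
    rw [Algebra.adjoin_singleton_eq_range_aeval] at hx
    obtain ⟨q, rfl⟩ := hx
    have hq : q ∈ Submodule.span R (Set.range fun k : ℕ => S R k) :=
      span_chebyshev_S R ▸ Submodule.mem_top
    have hq' := Submodule.mem_map_of_mem (f := (aeval a).toLinearMap) hq
    rw [Submodule.map_span, ← Set.range_comp, ← Nat.range_of_succ] at hq'
    simpa [Function.comp_def, Set.singleton_union] using hq'
  obtain ⟨c, y, hy, rfl⟩ := Submodule.mem_span_insert.1 hx'
  have hc : c = 0 := by simpa [hφ, LinearMap.mem_ker.1 (hK hy)] using hx0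
  rwa [hc, zero_smul, zero_add]

variable {R ι : Type*} [CommRing R] [DecidableEq ι]

theorem wick_replicate_append {i : ι} {v : List ι} (hv : v.head? ≠ some i) :
    ∀ k : ℕ, wick R (List.replicate k i ++ v) = aeval (FreeAlgebra.ι R i) (S R k) * wick R v
  | 0 => by simp
  | 1 => by
    cases v with
    | nil => simp [wick]
    | cons j v =>
      have hij : i ≠ j := by simpa [eq_comm] using hv
      simp [wick, hij]
  | k + 2 => by
    have hk := wick_replicate_append hv k
    have hk1 := wick_replicate_append hv (k + 1)
    simp only [List.replicate_succ, List.cons_append] at hk1 ⊢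
    rw [wick, if_pos rfl, hk1, hk]
    push_cast
    rw [S_add_two, map_sub, map_mul, Polynomial.aeval_X, sub_mul, mul_assoc]

theorem wick_replicate (i : ι) (k : ℕ) :
    wick R (List.replicate k i) = aeval (FreeAlgebra.ι R i) (S R k) := by
  simpa [wick] using wick_replicate_append (R := R) (i := i) (v := []) (by simp) k

theorem IsWickLaw.map_aeval_chebyshev_S {J : FreeAlgebra R ι →ₗ[R] R} (h : IsWickLaw J) (i : ι)
    (k : ℕ) : J (aeval (FreeAlgebra.ι R i) (S R k)) = if k = 0 then 1 else 0 := by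
  simp [← wick_replicate, h (List.replicate k i)]

variable {J : FreeAlgebra ℂ ι →ₗ[ℂ] ℂ}

theorem IsWickLaw.mem_span_of_isAlternatingProduct (h : IsWickLaw J) {o : Option ι}
    {p : FreeAlgebra ℂ ι}
    (hp : IsAlternatingProduct J (fun i => Algebra.adjoin ℂ {FreeAlgebra.ι ℂ i}) o p) :
    p ∈ Submodule.span ℂ (wick ℂ '' {v | v.head? = o}) := by
  induction hp with
  | one => exact Submodule.subset_span ⟨[], rfl, rfl⟩
  | @mul o i a b ha hJa ho _ ih =>
    have ha' := mem_span_aeval_chebyshev_S_succ h.map_one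
      (fun k => by simpa using h.map_aeval_chebyshev_S i (k + 1)) ha hJa
    have hab := Submodule.mul_mem_mul ha' ih
    rw [Submodule.span_mul_span] at hab
    refine Submodule.span_mono ?_ hab
    rintro _ ⟨_, ⟨k, rfl⟩, _, ⟨v, rfl, rfl⟩, rfl⟩
    exact ⟨List.replicate (k + 1) i ++ v, by simp [List.replicate_succ],
      wick_replicate_append ho (k + 1)⟩

theorem IsWickLaw.freelyIndependent (h : IsWickLaw J) :
    FreelyIndependent J (fun i => Algebra.adjoin ℂ {FreeAlgebra.ι ℂ i}) := by
  refine freelyIndependent_iff.2 fun i p hp => ?_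
  have hker : Submodule.span ℂ (wick ℂ '' {v | v.head? = some i}) ≤ LinearMap.ker J := by
    refine Submodule.span_le.2 ?_
    rintro _ ⟨v, hv, rfl⟩
    exact (h v).trans (if_neg (by rintro rfl; simp at hv))
  exact hker (h.mem_span_of_isAlternatingProduct hp)

theorem isAlternatingProduct_wick_replicate_append
    (hJ : ∀ (i : ι) (k : ℕ), J (aeval (FreeAlgebra.ι ℂ i) (S ℂ (k + 1 : ℕ))) = 0) (v : List ι) :
    ∀ (i : ι) (k : ℕ), IsAlternatingProduct J (fun i => Algebra.adjoin ℂ {FreeAlgebra.ι ℂ i})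
      (some i) (wick ℂ (List.replicate (k + 1) i ++ v)) := by
  have haeval (i : ι) (k : ℕ) : aeval (FreeAlgebra.ι ℂ i) (S ℂ (k + 1 : ℕ)) ∈
      Algebra.adjoin ℂ {FreeAlgebra.ι ℂ i} := Polynomial.aeval_mem_adjoin_singleton _ _
  induction v with
  | nil =>
    intro i k
    rw [wick_replicate_append (by simp)]
    exact .mul (haeval i k) (hJ i k) (by simp) .one
  | cons j v ih =>
    intro i k
    by_cases hij : i = j
    · subst hij
      simpa [List.replicate_succ', List.append_assoc] using ih i (k + 1)
    · rw [wick_replicate_append (by simpa [eq_comm] using hij)]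
      exact .mul (haeval i k) (hJ i k) (by simpa [eq_comm] using hij) (ih j 0)

theorem FreelyIndependent.isWickLaw
    (hfree : FreelyIndependent J (fun i => Algebra.adjoin ℂ {FreeAlgebra.ι ℂ i})) (hone : J 1 = 1)
    (hJ : ∀ (i : ι) (k : ℕ), J (aeval (FreeAlgebra.ι ℂ i) (S ℂ (k + 1 : ℕ))) = 0) :
    IsWickLaw J
  | [] => by simpa [wick] using hone
  | i :: v =>
    freelyIndependent_iff.1 hfree i _ (isAlternatingProduct_wick_replicate_append hJ v i 0)

end FreenessWick

/-! ### Moments of the semicircle and arcsine laws -/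

section Moments

theorem integral_arcsineLaw_eq_integral_measureT (f : ℝ → ℝ) :
    ∫ x, f x ∂arcsineLaw = Real.pi⁻¹ * ∫ y, f (2 * y) ∂measureT := by
  have hsqrt (y : ℝ) : √(4 - (2 * y) ^ 2) = 2 * √(1 - y ^ 2) := by
    rw [show 4 - (2 * y) ^ 2 = 2 ^ 2 * (1 - y ^ 2) by ring, Real.sqrt_mul (by norm_num),
      Real.sqrt_sq (by norm_num)]
  have hsupport : ∀ x ∉ Set.Ioc (2 * (-1) : ℝ) (2 * 1), 1 / (Real.pi * √(4 - x ^ 2)) * f x = 0 := by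
    intro x hx
    have hx2 : 4 - x ^ 2 ≤ 0 := by
      by_contra! h
      exact hx ⟨by nlinarith, by nlinarith⟩
    simp [Real.sqrt_eq_zero_of_nonpos hx2]
  calc ∫ x, f x ∂arcsineLaw
      = ∫ x, 1 / (Real.pi * √(4 - x ^ 2)) * f x := by
        rw [arcsineLaw, integral_withDensity_eq_integral_toReal_smul (by fun_prop)
          (.of_forall fun _ => ENNReal.ofReal_lt_top)]
        refine integral_congr_ae (.of_forall fun x => ?_)
        simp only [smul_eq_mul, ENNReal.toReal_ofReal
          (show 0 ≤ 1 / (Real.pi * √(4 - x ^ 2)) by positivity)]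
    _ = ∫ x in (2 * (-1))..(2 * 1), 1 / (Real.pi * √(4 - x ^ 2)) * f x := by
        rw [intervalIntegral.integral_of_le (by norm_num),
          setIntegral_eq_integral_of_forall_compl_eq_zero hsupport]
    _ = Real.pi⁻¹ * ∫ y, f (2 * y) ∂measureT := by
        rw [← intervalIntegral.mul_integral_comp_mul_left,
          Polynomial.Chebyshev.integral_measureT, ← intervalIntegral.integral_const_mul,
          ← intervalIntegral.integral_const_mul]
        congr 1 with y
        rw [hsqrt, Real.sqrt_inv]
        field_simp

theorem integral_semicircleLaw_eq_integral_arcsineLaw (f : ℝ → ℝ) :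
    ∫ x, f x ∂semicircleLaw = ∫ x, (4 - x ^ 2) / 2 * f x ∂arcsineLaw := by
  rw [semicircleLaw, arcsineLaw,
    integral_withDensity_eq_integral_toReal_smul (by fun_prop)
      (.of_forall fun _ => ENNReal.ofReal_lt_top),
    integral_withDensity_eq_integral_toReal_smul (by fun_prop)
      (.of_forall fun _ => ENNReal.ofReal_lt_top)]
  refine integral_congr_ae (.of_forall fun x => ?_)
  simp only [smul_eq_mul]
  rw [ENNReal.toReal_ofReal (by positivity), ENNReal.toReal_ofReal (by positivity)]
  rcases le_or_gt (4 - x ^ 2) 0 with h | h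
  · simp [Real.sqrt_eq_zero_of_nonpos h]
  · have hne := (Real.sqrt_pos.2 h).ne'
    field_simp [hne]
    rw [Real.sq_sqrt h.le]

theorem integral_semicircleLaw_eq_integral_measureT (f : ℝ → ℝ) :
    ∫ x, f x ∂semicircleLaw = 2 / Real.pi * ∫ y, (1 - y ^ 2) * f (2 * y) ∂measureT := by
  rw [integral_semicircleLaw_eq_integral_arcsineLaw, integral_arcsineLaw_eq_integral_measureT,
    ← integral_const_mul, ← integral_const_mul]
  congr 1 with y
  ring

theorem integral_pow_add_two_measureT (n : ℕ) :
    ∫ y, y ^ (n + 2) ∂measureT = (n + 1) / (n + 2) * ∫ y, y ^ n ∂measureT := by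
  simp only [Polynomial.Chebyshev.integral_measureT_eq_integral_cos]
  simp [integral_cos_pow]

theorem moment_arcsineLaw (n : ℕ) :
    moment arcsineLaw n = (n / 2 + 1) * moment semicircleLaw n := by
  have hpow (k : ℕ) : Integrable (fun y : ℝ => y ^ k) measureT :=
    Polynomial.Chebyshev.integrable_measureT (by fun_prop)
  have hsemicircle : ∫ x, x ^ n ∂semicircleLaw =
      2 / Real.pi * (2 ^ n * (∫ y, y ^ n ∂measureT - ∫ y, y ^ (n + 2) ∂measureT)) := by
    rw [integral_semicircleLaw_eq_integral_measureT, ← integral_sub (hpow n) (hpow (n + 2)),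
      ← integral_const_mul (2 ^ n)]
    congr 2 with y
    ring
  have harcsine : ∫ x, x ^ n ∂arcsineLaw = Real.pi⁻¹ * (2 ^ n * ∫ y, y ^ n ∂measureT) := by
    simp [integral_arcsineLaw_eq_integral_measureT, mul_pow, integral_const_mul]
  have hreal : ∫ x, x ^ n ∂arcsineLaw = (n / 2 + 1) * ∫ x, x ^ n ∂semicircleLaw := by
    rw [hsemicircle, harcsine, integral_pow_add_two_measureT]
    field_simp
    ring
  simp [moment, hreal]

theorem integrable_semicircleLaw {f : ℝ → ℝ} (hf : Continuous f) :
    Integrable f semicircleLaw := by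
  rw [semicircleLaw, integrable_withDensity_iff_integrable_smul' (by fun_prop) (by simp)]
  have hsupport : HasCompactSupport fun x : ℝ => √(4 - x ^ 2) / (2 * Real.pi) := by
    refine HasCompactSupport.of_support_subset_isCompact (isCompact_Icc (a := -2) (b := 2)) ?_
    intro x hx
    have hx2 : 0 < 4 - x ^ 2 := Real.sqrt_pos.1 <|
      (Real.sqrt_nonneg _).lt_of_ne' fun h => hx (by simp [h])
    constructor <;> nlinarith
  have hint : Integrable fun x => √(4 - x ^ 2) / (2 * Real.pi) * f x :=
    Continuous.integrable_of_hasCompactSupport (by fun_prop) hsupport.mul_right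
  refine hint.congr (.of_forall fun x => ?_)
  simp only [smul_eq_mul, ENNReal.toReal_ofReal
    (show 0 ≤ √(4 - x ^ 2) / (2 * Real.pi) by positivity)]

theorem integral_chebyshev_S_semicircleLaw (k : ℕ) :
    ∫ x, (S ℝ k).eval x ∂semicircleLaw = if k = 0 then 1 else 0 := by
  have hT (n : ℤ) : Integrable (fun y => (T ℝ n).eval y) measureT :=
    Polynomial.Chebyshev.integrable_measureT (by fun_prop)
  -- With `y = cos θ` this is `2 sin θ sin ((k + 1) θ) = cos (k θ) - cos ((k + 2) θ)`.
  have hST (y : ℝ) : (1 - y ^ 2) * (S ℝ k).eval (2 * y) =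
      ((T ℝ k).eval y - (T ℝ (k + 2)).eval y) / 2 := by
    have hU := congrArg (Polynomial.eval y)
      (Polynomial.Chebyshev.one_sub_X_sq_mul_U_eq_pol_in_T ℝ k)
    have hadd := congrArg (Polynomial.eval y) (Polynomial.Chebyshev.T_add_two ℝ k)
    rw [← Polynomial.Chebyshev.S_comp_two_mul_X] at hU
    simp only [Polynomial.eval_mul, Polynomial.eval_sub, Polynomial.eval_pow, Polynomial.eval_X,
      Polynomial.eval_comp, Polynomial.eval_one, Polynomial.eval_ofNat] at hU hadd
    linear_combination hU - hadd / 2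
  rw [integral_semicircleLaw_eq_integral_measureT]
  simp_rw [hST, integral_div]
  rw [integral_sub (hT _) (hT _),
    Polynomial.Chebyshev.integral_eval_T_real_measureT_of_ne_zero (n := k + 2) (by lia)]
  split_ifs with hk
  · rw [hk, Nat.cast_zero, Polynomial.Chebyshev.integral_eval_T_real_measureT_zero]
    field_simp
    simp
  · simp [Polynomial.Chebyshev.integral_eval_T_real_measureT_of_ne_zero (Nat.cast_ne_zero.2 hk)]

/-- Integration of complex polynomials against a measure on the line, encoded through its
moments. -/
def momentFunctional (ν : Measure ℝ) : Polynomial ℂ →ₗ[ℂ] ℂ :=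
  Polynomial.lsum fun n => LinearMap.lsmul ℂ ℂ (moment ν n)

theorem momentFunctional_X_pow (ν : Measure ℝ) (n : ℕ) :
    momentFunctional ν (Polynomial.X ^ n) = moment ν n := by
  simp [momentFunctional, Polynomial.lsum_apply, Polynomial.X_pow_eq_monomial]

theorem momentFunctional_eq_integral {ν : Measure ℝ} (hν : ∀ n : ℕ, Integrable (fun x => x ^ n) ν)
    (p : Polynomial ℂ) : momentFunctional ν p = ∫ x, p.eval (x : ℂ) ∂ν := by
  have hpow (n : ℕ) : Integrable (fun x : ℝ => (x : ℂ) ^ n) ν := mod_cast (hν n).ofReal (𝕜 := ℂ)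
  have heval (p : Polynomial ℂ) : Integrable (fun x : ℝ => p.eval (x : ℂ)) ν := by
    simp only [Polynomial.eval_eq_sum_range]
    exact integrable_finsetSum _ fun n _ => (hpow n).const_mul _
  induction p using Polynomial.induction_on' with
  | add p q hp hq =>
    simp only [map_add, Polynomial.eval_add, integral_add (heval p) (heval q), hp, hq]
  | monomial n a =>
    have hmoment : moment ν n = ∫ x, (x : ℂ) ^ n ∂ν := by
      simp only [moment, ← integral_complex_ofReal, Complex.ofReal_pow]
    simp only [Polynomial.eval_monomial, integral_const_mul, ← hmoment]
    simp [momentFunctional, Polynomial.lsum_apply, mul_comm]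

theorem momentFunctional_semicircleLaw_chebyshev_S (k : ℕ) :
    momentFunctional semicircleLaw (S ℂ k) = if k = 0 then 1 else 0 := by
  rw [momentFunctional_eq_integral fun n => integrable_semicircleLaw (continuous_pow n)]
  simp_rw [← Polynomial.Chebyshev.complex_ofReal_eval_S]
  rw [integral_complex_ofReal, integral_chebyshev_S_semicircleLaw]
  split_ifs <;> simp

end Moments

section SemicircularVariables

variable {A : Type*} [Ring A] [Algebra ℂ A] {φ : A →ₗ[ℂ] ℂ}

theorem isSemicircularVar_iff_map_chebyshev_S {a : A} :
    IsSemicircularVar φ a ↔ ∀ k : ℕ, φ (aeval a (S ℂ k)) = if k = 0 then 1 else 0 := by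
  trans φ ∘ₗ (aeval a).toLinearMap = momentFunctional semicircleLaw
  · refine ⟨fun h => ?_, fun h n => ?_⟩
    · refine Polynomial.lhom_ext' fun n => LinearMap.ext_ring ?_
      simpa [← Polynomial.X_pow_eq_monomial, momentFunctional_X_pow] using h n
    · simpa [momentFunctional_X_pow] using LinearMap.congr_fun h (Polynomial.X ^ n)
  · refine ⟨fun h k => ?_, fun h => LinearMap.ext_on (span_chebyshev_S ℂ) ?_⟩
    · simpa [momentFunctional_semicircleLaw_chebyshev_S] using LinearMap.congr_fun h (S ℂ k)
    · rintro _ ⟨k, rfl⟩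
      simpa [momentFunctional_semicircleLaw_chebyshev_S] using h k

theorem IsWickLaw.isFreeSemicircularFamily {ι : Type*} [DecidableEq ι]
    {J : FreeAlgebra ℂ ι →ₗ[ℂ] ℂ} (h : IsWickLaw J) :
    IsFreeSemicircularFamily J (FreeAlgebra.ι ℂ) where
  semicircular i := isSemicircularVar_iff_map_chebyshev_S.2 (h.map_aeval_chebyshev_S i)
  free := h.freelyIndependent

theorem isFreeSemicircularFamily_ι_standardSemicircularLaw (ι : Type*) :
    IsFreeSemicircularFamily (standardSemicircularLaw ι) (FreeAlgebra.ι ℂ) := by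
  classical exact (isWickLaw_standardSemicircularLaw ι).isFreeSemicircularFamily

theorem FreelyIndependent.jointLaw_ι {ι : Type*} {s : ι → A}
    (h : FreelyIndependent φ fun i => Algebra.adjoin ℂ {s i}) :
    FreelyIndependent (jointLaw φ s) fun i => Algebra.adjoin ℂ {FreeAlgebra.ι ℂ i} :=
  h.comap (FreeAlgebra.lift ℂ s) fun i => Algebra.adjoin_le <| by
    simp [Algebra.self_mem_adjoin_singleton]

theorem IsFreeSemicircularFamily.jointLaw_eq {ι : Type*} {s : ι → A}
    (h : IsFreeSemicircularFamily φ s) (hφ : φ 1 = 1) :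
    jointLaw φ s = standardSemicircularLaw ι := by
  classical
  refine IsWickLaw.eq (FreelyIndependent.isWickLaw h.free.jointLaw_ι (by simpa [jointLaw] using hφ)
    fun i k => ?_) (isWickLaw_standardSemicircularLaw ι)
  have hS := isSemicircularVar_iff_map_chebyshev_S.1 (h.semicircular i) (k + 1)
  simpa [jointLaw, ← Polynomial.aeval_algHom_apply] using hS

end SemicircularVariables

/-! ### Free semicircular families of arbitrary variance -/

section Variance

/-- The endomorphism of the noncommutative polynomials multiplying all variables by `c`. -/
def scaleHom (ι : Type*) (c : ℂ) : FreeAlgebra ℂ ι →ₐ[ℂ] FreeAlgebra ℂ ι :=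
  FreeAlgebra.lift ℂ (c • FreeAlgebra.ι ℂ)

variable {ι : Type*}

theorem scaleHom_ι (c : ℂ) (i : ι) : scaleHom ι c (FreeAlgebra.ι ℂ i) = c • FreeAlgebra.ι ℂ i := by
  simp [scaleHom]

theorem scaleHom_one : scaleHom ι 1 = AlgHom.id ℂ _ := by
  ext i
  simp [scaleHom_ι]

theorem scaleHom_prod_map_ι (c : ℂ) (v : List ι) :
    scaleHom ι c (v.map (FreeAlgebra.ι ℂ)).prod =
      c ^ v.length • (v.map (FreeAlgebra.ι ℂ)).prod := by
  induction v with
  | nil => simp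
  | cons i v ih => simp [ih, scaleHom_ι, smul_smul, pow_succ]

theorem jointLaw_smul {A : Type*} [Ring A] [Algebra ℂ A] (φ : A →ₗ[ℂ] ℂ) (c : ℂ) (x : ι → A) :
    jointLaw φ (c • x) = jointLaw φ x ∘ₗ (scaleHom ι c).toLinearMap := by
  have hlift : FreeAlgebra.lift ℂ (c • x) = (FreeAlgebra.lift ℂ x).comp (scaleHom ι c) := by
    ext i
    simp [scaleHom_ι]
  rw [jointLaw, hlift]
  rfl

/-- The joint law of a free family of semicircular variables of variance `v`. -/
def freeSemicircularLaw (ι : Type*) (v : ℝ) : FreeAlgebra ℂ ι →ₗ[ℂ] ℂ :=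
  standardSemicircularLaw ι ∘ₗ (scaleHom ι (√v : ℝ)).toLinearMap

theorem freeSemicircularLaw_one : freeSemicircularLaw ι 1 = standardSemicircularLaw ι := by
  simp [freeSemicircularLaw, scaleHom_one]

theorem freeSemicircularLaw_map_one (v : ℝ) : freeSemicircularLaw ι v 1 = 1 := by
  classical
  simp [freeSemicircularLaw, (isWickLaw_standardSemicircularLaw ι).map_one]

theorem freeSemicircularLaw_prod_map_ι (v : ℝ) (w : List ι) :
    freeSemicircularLaw ι v (w.map (FreeAlgebra.ι ℂ)).prod =
      (√v : ℝ) ^ w.length * standardSemicircularLaw ι (w.map (FreeAlgebra.ι ℂ)).prod := by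
  simp [freeSemicircularLaw, scaleHom_prod_map_ι]

theorem freelyIndependent_freeSemicircularLaw (v : ℝ) :
    FreelyIndependent (freeSemicircularLaw ι v)
      (fun i => Algebra.adjoin ℂ {FreeAlgebra.ι ℂ i}) :=
  (isFreeSemicircularFamily_ι_standardSemicircularLaw ι).free.comap _ fun i =>
    Algebra.adjoin_singleton_le <| by
      rw [Subalgebra.mem_comap, scaleHom_ι]
      exact Subalgebra.smul_mem _ (Algebra.self_mem_adjoin_singleton ℂ _) _

theorem IsLadderSystem.jointLaw_eq {B : Type*} [Ring B] [Algebra ℂ B] [DecidableEq ι]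
    {φ : B →ₗ[ℂ] ℂ} {v : ℝ} {a b : ι → B} (h : IsLadderSystem φ (v : ℂ) a b) (hφ : φ 1 = 1)
    (hv : 0 < v) : jointLaw φ (a + b) = freeSemicircularLaw ι v := by
  set c : ℂ := Complex.ofReal √v
  have hc : c ^ 2 = v := by rw [← Complex.ofReal_pow, Real.sq_sqrt hv.le]
  have hc0 : c ≠ 0 := Complex.ofReal_ne_zero.2 (Real.sqrt_pos.2 hv).ne'
  have hstd : IsLadderSystem φ 1 (c⁻¹ • a) (c⁻¹ • b) := by
    simpa [← hc, hc0] using h.smul c⁻¹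
  have hab : a + b = c • (c⁻¹ • a + c⁻¹ • b) := by
    rw [← smul_add, smul_inv_smul₀ hc0]
  have hlaw : jointLaw φ (c⁻¹ • a + c⁻¹ • b) = standardSemicircularLaw ι :=
    (hstd.isWickLaw hφ).eq (isWickLaw_standardSemicircularLaw ι)
  rw [hab, jointLaw_smul, hlaw, freeSemicircularLaw]

end Variance

/-! ### Matrices of semicircular variables -/

section MatrixModel

variable {N m : ℕ} {A : Type*} [Ring A] [Algebra ℂ A] {φ : A →ₗ[ℂ] ℂ}

theorem matrixFunctional_apply (M : Matrix (Fin N) (Fin N) A) :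
    matrixFunctional φ N M = 1 / (N : ℂ) * ∑ i, φ (M i i) := by
  simp [matrixFunctional, Matrix.trace]

theorem matrixFunctional_one (hφ : φ 1 = 1) (hN : N ≠ 0) : matrixFunctional φ N 1 = 1 := by
  simp [matrixFunctional_apply, hφ, hN]

/-- The index of the semicircular variable at the entries `(i, j)` and `(j, i)` of the `k`-th
matrix. -/
def entryIndex (i j : Fin N) (k : Fin m) : EntryIndex N m :=
  ⟨(min i j, max i j, k), min_le_max⟩

theorem entryIndex_eq_entryIndex_iff {i j r : Fin N} {k l : Fin m} :
    entryIndex i r k = entryIndex r j l ↔ k = l ∧ i = j := by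
  simp only [entryIndex, Subtype.mk.injEq, Prod.mk.injEq]
  constructor
  · rintro ⟨hmin, hmax, hkl⟩
    refine ⟨hkl, ?_⟩
    grind
  · rintro ⟨rfl, rfl⟩
    exact ⟨min_comm _ _, max_comm _ _, rfl⟩

/-- The standard deviation of the entries `(i, j)` of the matrices `X_N(k)`. -/
def entryScale (i j : Fin N) : ℝ := √((1 + if i = j then 1 else 0) / N)

theorem semicircularMatrix_apply (s : EntryIndex N m → A) (k : Fin m) (i j : Fin N) :
    semicircularMatrix s k i j = (entryScale i j : ℂ) • s (entryIndex i j k) := rfl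

theorem semicircularMatrix_add (s s' : EntryIndex N m → A) :
    semicircularMatrix (s + s') = semicircularMatrix s + semicircularMatrix s' := by
  ext k i j
  simp [semicircularMatrix_apply]

theorem sum_entryScale_mul_entryScale (i : Fin N) :
    ∑ r, entryScale i r * entryScale r i = 1 + 1 / (N : ℝ) := by
  have hmul (r : Fin N) : entryScale i r * entryScale r i =
      1 / (N : ℝ) + if i = r then 1 / (N : ℝ) else 0 := by
    simp only [entryScale, eq_comm (a := r)]
    rw [Real.mul_self_sqrt (by positivity)]
    split_ifs <;> ring
  have hN : N ≠ 0 := i.pos.ne'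
  simp [hmul, Finset.sum_add_distrib, hN]

theorem IsLadderSystem.semicircularMatrix {v : ℂ} {a b : EntryIndex N m → A}
    (h : IsLadderSystem φ v a b) :
    IsLadderSystem (matrixFunctional φ N) ((1 + 1 / (N : ℂ)) * v) (semicircularMatrix a)
      (semicircularMatrix b) where
  annihilation_mul_creation k l := by
    ext i j : 1
    simp only [Matrix.mul_apply, semicircularMatrix_apply, smul_mul_smul_comm,
      h.annihilation_mul_creation, entryIndex_eq_entryIndex_iff]
    by_cases hkl : k = l
    · by_cases hij : i = j
      · subst hij
        have hsum := congrArg Complex.ofReal (sum_entryScale_mul_entryScale i)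
        push_cast at hsum
        simp only [hkl, and_self, if_true, ← Finset.sum_smul, smul_smul, ← Finset.sum_mul, hsum,
          Matrix.smul_apply, Matrix.one_apply_eq]
      · simp [hkl, hij]
    · simp [hkl]
  map_creation_mul k Y := by
    simp [matrixFunctional_apply, Matrix.mul_apply, semicircularMatrix_apply, h.map_creation_mul]
  map_mul_annihilation k Y := by
    simp [matrixFunctional_apply, Matrix.mul_apply, semicircularMatrix_apply,
      h.map_mul_annihilation]

theorem jointLaw_semicircularMatrix (s : EntryIndex N m → A) :
    jointLaw (matrixFunctional φ N) (semicircularMatrix s) =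
      jointLaw (matrixFunctional (jointLaw φ s) N) (semicircularMatrix (FreeAlgebra.ι ℂ)) := by
  have hlift : FreeAlgebra.lift ℂ (semicircularMatrix s) =
      (FreeAlgebra.lift ℂ s).mapMatrix.comp
        (FreeAlgebra.lift ℂ (semicircularMatrix (FreeAlgebra.ι ℂ))) := by
    ext k i j
    simp only [Function.comp_apply, FreeAlgebra.lift_ι_apply, AlgHom.coe_comp,
      AlgHom.mapMatrix_apply, Matrix.map_apply, semicircularMatrix_apply, map_smul]
  ext p
  simp [jointLaw, matrixFunctional_apply, hlift]

theorem IsFreeSemicircularFamily.jointLaw_semicircularMatrix_eq {s : EntryIndex N m → A}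
    (hs : IsFreeSemicircularFamily φ s) (hφ : φ 1 = 1) (hN : N ≠ 0) :
    jointLaw (matrixFunctional φ N) (semicircularMatrix s) =
      freeSemicircularLaw (Fin m) (1 + 1 / N) := by
  have hladder := (isLadderSystem_fock (R := ℂ) (ι := EntryIndex N m)).semicircularMatrix
  rw [jointLaw_semicircularMatrix, hs.jointLaw_eq hφ, standardSemicircularLaw,
    ← jointLaw_semicircularMatrix, semicircularMatrix_add]
  exact IsLadderSystem.jointLaw_eq (by simpa using hladder)
    (matrixFunctional_one vacuumState_one hN) (by positivity)

end MatrixModel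

/-! ### Infinitesimal laws as derivatives of laws -/

section CenteredProducts

theorem map_mul_prod_sub_cons {R B : Type*} [CommRing R] [Ring B] [Algebra R B]
    (φ : B →ₗ[R] R) (c : B → R) (a b : B) (w : List B) :
    φ (a * ((b :: w).map fun x => x - algebraMap R B (c x)).prod) =
      φ (a * b * (w.map fun x => x - algebraMap R B (c x)).prod) -
        c b * φ (a * (w.map fun x => x - algebraMap R B (c x)).prod) := by
  simp [sub_mul, mul_sub, mul_assoc, Algebra.algebraMap_eq_smul_one]

variable {α 𝕜 B : Type*} [NormedField 𝕜] [Ring B] [Algebra 𝕜 B] {l : Filter α}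
  {φ ψ : α → B →ₗ[𝕜] 𝕜}

theorem isBigO_one_map_mul_prod_sub (hφ : ∀ b, (fun t => φ t b) =O[l] fun _ => (1 : ℝ))
    (w : List B) (a : B) :
    (fun t => φ t (a * (w.map fun x => x - algebraMap 𝕜 B (φ t x)).prod))
      =O[l] fun _ => (1 : ℝ) := by
  induction w generalizing a with
  | nil => simpa using hφ a
  | cons b w ih =>
    have hsecond := (hφ b).mul (ih a)
    simp only [one_mul] at hsecond
    simpa only [map_mul_prod_sub_cons] using (ih (a * b)).sub hsecond

theorem isLittleO_map_mul_prod_sub_sub {u : α → ℝ}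
    (hφ : ∀ b, (fun t => φ t b) =O[l] fun _ => (1 : ℝ))
    (hψ : ∀ b, (fun t => ψ t b) =O[l] fun _ => (1 : ℝ))
    (h : ∀ b, (fun t => φ t b - ψ t b) =o[l] u) (w : List B) (a : B) :
    (fun t => φ t (a * (w.map fun x => x - algebraMap 𝕜 B (φ t x)).prod) -
      ψ t (a * (w.map fun x => x - algebraMap 𝕜 B (ψ t x)).prod)) =o[l] u := by
  induction w generalizing a with
  | nil => simpa using h a
  | cons b w ih =>
    have hfirst := (hφ b).mul_isLittleO (ih a)
    have hsecond := (h b).mul_isBigO (isBigO_one_map_mul_prod_sub hψ w a)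
    simp only [one_mul, mul_one] at hfirst hsecond
    refine (((ih (a * b)).sub hfirst).sub hsecond).congr_left fun t => ?_
    simp only [map_mul_prod_sub_cons]
    ring

end CenteredProducts

namespace InfinitesimalLaw

variable {ι : Type*} {μ : ℝ → FreeAlgebra ℂ ι →ₗ[ℂ] ℂ}

/-- The infinitesimal law `(μ 0, d/dt μ t at 0)` of a differentiable curve of laws `t ↦ μ t`. -/
def ofCurve (μ : ℝ → FreeAlgebra ℂ ι →ₗ[ℂ] ℂ) (hμ : ∀ t, μ t 1 = 1)
    (hd : ∀ p, DifferentiableAt ℝ (fun t => μ t p) 0) : InfinitesimalLaw ι where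
  zeroth := μ 0
  first :=
    { toFun := fun p => deriv (fun t => μ t p) 0
      map_add' := fun p q => by
        simp only [map_add]
        exact deriv_fun_add (hd p) (hd q)
      map_smul' := fun c p => by
        simp only [map_smul, smul_eq_mul, RingHom.id_apply]
        exact deriv_const_mul c (hd p) }
  zeroth_one := hμ 0
  first_one := by simp [hμ]

theorem isBigO_one_lawAt (L : InfinitesimalLaw ι) (p : FreeAlgebra ℂ ι) :
    (fun t => L.lawAt t p) =O[𝓝 0] fun _ => (1 : ℝ) := by
  refine (Continuous.tendsto ?_ 0).isBigO_one ℝ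
  simp only [lawAt, LinearMap.add_apply, LinearMap.smul_apply]
  fun_prop

variable (hμ : ∀ t, μ t 1 = 1) (hd : ∀ p, DifferentiableAt ℝ (fun t => μ t p) 0)

include hd in
theorem hasDerivAt_ofCurve (p : FreeAlgebra ℂ ι) :
    HasDerivAt (fun t => μ t p) ((ofCurve μ hμ hd).first p) 0 :=
  (hd p).hasDerivAt

theorem isLittleO_ofCurve_lawAt_sub (p : FreeAlgebra ℂ ι) :
    (fun t => (ofCurve μ hμ hd).lawAt t p - μ t p) =o[𝓝 0] fun t : ℝ => t := by
  have h := hasDerivAt_iff_isLittleO.1 (hasDerivAt_ofCurve hμ hd p)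
  simp only [sub_zero] at h
  refine h.neg_left.congr_left fun t => ?_
  simp only [lawAt, LinearMap.add_apply, LinearMap.smul_apply, Complex.real_smul, smul_eq_mul]
  simp only [ofCurve]
  ring

theorem isInfinitesimalLimit_ofCurve {φ : ℕ → FreeAlgebra ℂ ι →ₗ[ℂ] ℂ}
    (hφ : ∀ᶠ N : ℕ in atTop, φ N = μ (1 / N)) :
    (ofCurve μ hμ hd).IsInfinitesimalLimit φ := by
  have hinv : Tendsto (fun N : ℕ => 1 / (N : ℝ)) atTop (𝓝[≠] 0) :=
    tendsto_nhdsWithin_iff.2 ⟨tendsto_one_div_atTop_nhds_zero_nat,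
      (eventually_ne_atTop 0).mono fun N hN => by simpa using hN⟩
  intro p
  constructor
  · refine ((hd p).continuousAt.tendsto.comp (hinv.mono_right nhdsWithin_le_nhds)).congr' ?_
    filter_upwards [hφ] with N hN
    simp [hN]
  · refine ((hasDerivAt_iff_tendsto_slope_zero.1 (hasDerivAt_ofCurve hμ hd p)).comp
      hinv).congr' ?_
    filter_upwards [hφ] with N hN
    simp [hN, ofCurve, div_eq_inv_mul]

theorem infinitesimallyFree_ofCurve {κ : Type*} {S : κ → Subalgebra ℂ (FreeAlgebra ℂ ι)}
    (hS : ∀ᶠ t in 𝓝[≠] 0, FreelyIndependent (μ t) S) :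
    (ofCurve μ hμ hd).InfinitesimallyFree S := by
  intro w hw hmem hchain
  have hdiff := (isLittleO_map_mul_prod_sub_sub (isBigO_one_lawAt (ofCurve μ hμ hd))
    (fun p => (hd p).continuousAt.isBigO_one ℝ) (isLittleO_ofCurve_lawAt_sub hμ hd)
    (w.map Prod.snd) 1).mono (nhdsWithin_le_nhds (s := {0}ᶜ))
  refine hdiff.congr' ?_ .rfl
  filter_upwards [hS] with t ht
  simpa [Function.comp_def] using ht.map_prod_sub (hμ t) hw hmem hchain

end InfinitesimalLaw

section InfinitesimalSemicircularLaw

variable {ι : Type*}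

theorem hasDerivAt_sqrt_one_add_pow (n : ℕ) :
    HasDerivAt (fun t : ℝ => √(1 + t) ^ n) (n / 2) 0 := by
  have h := (((hasDerivAt_id' (0 : ℝ)).const_add 1).sqrt (by norm_num)).fun_pow n
  exact h.congr_deriv (by simp [div_eq_mul_inv])

theorem hasDerivAt_freeSemicircularLaw_one_add_prod_map_ι (w : List ι) :
    HasDerivAt (fun t : ℝ => freeSemicircularLaw ι (1 + t) (w.map (FreeAlgebra.ι ℂ)).prod)
      (w.length / 2 * standardSemicircularLaw ι (w.map (FreeAlgebra.ι ℂ)).prod) 0 := by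
  simp only [freeSemicircularLaw_prod_map_ι]
  simpa using (hasDerivAt_sqrt_one_add_pow w.length).ofReal_comp.mul_const
    (standardSemicircularLaw ι (w.map (FreeAlgebra.ι ℂ)).prod)

theorem differentiableAt_freeSemicircularLaw_one_add (p : FreeAlgebra ℂ ι) :
    DifferentiableAt ℝ (fun t : ℝ => freeSemicircularLaw ι (1 + t) p) 0 := by
  have hp : p ∈ Submodule.span ℂ
      (Set.range fun w : List ι => (w.map (FreeAlgebra.ι ℂ)).prod) := by
    simp [span_prod_map_ι]
  induction hp using Submodule.span_induction with
  | mem _ h =>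
    obtain ⟨w, rfl⟩ := h
    exact (hasDerivAt_freeSemicircularLaw_one_add_prod_map_ι w).differentiableAt
  | zero => simp
  | add p q _ _ hp hq => simpa using hp.fun_add hq
  | smul c p _ hp => simpa using hp.const_mul c

/-- The joint law, to first order in `t`, of a free family of semicircular variables of variance
`1 + t`. -/
def infinitesimalSemicircularLaw (ι : Type*) : InfinitesimalLaw ι :=
  .ofCurve (fun t => freeSemicircularLaw ι (1 + t)) (fun _ => freeSemicircularLaw_map_one _)
    differentiableAt_freeSemicircularLaw_one_add

theorem variablesInfinitesimallyFree_infinitesimalSemicircularLaw :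
    (infinitesimalSemicircularLaw ι).VariablesInfinitesimallyFree :=
  InfinitesimalLaw.infinitesimallyFree_ofCurve _ _ <|
    .of_forall fun t => freelyIndependent_freeSemicircularLaw (1 + t)

theorem isSemicircular_restrict_infinitesimalSemicircularLaw (k : ι) :
    ((infinitesimalSemicircularLaw ι).restrict k).IsSemicircular := by
  intro n
  have hmoment : standardSemicircularLaw ι (FreeAlgebra.ι ℂ k ^ n) = moment semicircleLaw n :=
    (isFreeSemicircularFamily_ι_standardSemicircularLaw ι).semicircular k n
  have hderiv := (hasDerivAt_freeSemicircularLaw_one_add_prod_map_ι (List.replicate n k)).deriv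
  simp only [List.map_replicate, List.prod_replicate, List.length_replicate, hmoment] at hderiv
  constructor
  · simp [InfinitesimalLaw.restrict, infinitesimalSemicircularLaw, InfinitesimalLaw.ofCurve,
      freeSemicircularLaw_one, hmoment]
  · simp [InfinitesimalLaw.restrict, infinitesimalSemicircularLaw, InfinitesimalLaw.ofCurve,
      hderiv, moment_arcsineLaw]
    ring

end InfinitesimalSemicircularLaw

end InfFree

end

theorem mainTheorem9 (m : ℕ)
    (A : ℕ → Type*) [∀ N, Ring (A N)] [∀ N, Algebra ℂ (A N)]
    (ψ : ∀ N, A N →ₗ[ℂ] ℂ) (hψ : ∀ N, ψ N 1 = 1)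
    (s : ∀ N, InfFree.EntryIndex N m → A N)
    (hs : ∀ N, InfFree.IsFreeSemicircularFamily (ψ N) (s N)) :
    ∃ L : InfFree.InfinitesimalLaw (Fin m),
      L.IsInfinitesimalLimit (fun N =>
        InfFree.jointLaw (InfFree.matrixFunctional (ψ N) N)
          (fun k : Fin m => InfFree.semicircularMatrix (s N) k)) ∧
      L.VariablesInfinitesimallyFree ∧
      ∀ k : Fin m, (L.restrict k).IsSemicircular := by
  refine ⟨InfFree.infinitesimalSemicircularLaw (Fin m),
    InfFree.InfinitesimalLaw.isInfinitesimalLimit_ofCurve _ _ ?_,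
    InfFree.variablesInfinitesimallyFree_infinitesimalSemicircularLaw,
    InfFree.isSemicircular_restrict_infinitesimalSemicircularLaw⟩
  filter_upwards [eventually_ne_atTop 0] with N hN
  exact (hs N).jointLaw_semicircularMatrix_eq (hψ N) hN
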